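/- **Model.** Time is divided into slots $0,1,2,\dots$. In every slot each of $n\ge 2$ devices sharing one channel is idle, listens, or transmits a message from a set $\mathcal M$; listening and transmitting cost one unit of energy each. In the *Sender-CD* model every listener and every transmitter receives the message if exactly one device transmits, and a silence signal otherwise. The *No-CD* model is the same, except that transmitters receive no signal. All devices run the same randomized algorithm without knowing $n$: the state of a device is the list of its past actions and received signals; some states are terminal and carry an output; in every other state the next action is drawn independently from a discrete probability distribution that depends only on the state. A device that has reached a terminal state stays there and does nothing any more. **Problems.** - *Approximate Counting* with factor $\kappa\ge 1$: all devices terminate with the same output $\tilde n\in\mathbb R$, and $n/\kappa\le\tilde n\le\kappa n$. - *Leader Election*: exactly one device outputs "leader", all others output "follower", and all devices terminate after a common slot, in which the leader transmits and all followers listen. - *Contention Resolution*: all devices terminate, and each of them was the only transmitter in some slot. Let $T,E:\mathbb N\to\mathbb N$. An algorithm solves a problem in time $T$ (and with energy $E$) if for every $n\ge 2$, when it runs on $n$ devices, the following holds except with probability at most $1/n$: after $T(n)$ slots all devices have terminated and the problem is solved (and each device has spent at most $E(n)$ units of energy). Failed executions may run forever and use any amount of energy. Write $\log^* x$ for the least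 $k$ such that the $k$-fold iterate of $\log_2$ at $x$ is at most $1$. **Theorem.** Let $P$ be one of these problems, and let the model be Sender-CD or No-CD. 1. (Polynomial time.) There is an absolute constant $c>0$ such that for all $P$, $k$, $C$ there is $N_0$ with the following property. If an algorithm solves $P$ in time $T$ with energy $E$, where $T(n)\le C n^k$ for all $n\ge1$, then for every $N\ge N_0$ there is a network size $2\le n\le N$ with $E(n)\ge c\log^* N$; that is, $\max_{2\le n\le N}E(n)=\Omega(\log^* N)$. 2. (Towers.) For every $\alpha\in\mathbb N$ there is a constant $c>0$ such that for all $P$ and $C$ the same conclusion holds, with some $N_0$, for all algorithms whose time satisfies $T(n)\le C\cdot 2^{2^{\cdot^{\cdot^{2^{n}}}}}$ ($\alpha$ twos) for all $n\ge 1$. 3. (Detailed form.) For every $P$ there is a constant $D$ such that the following holds. Let $T$ be nondecreasing with $T(n)\ge n$ for all $n$, let an algorithm solve $P$ in time $T$, let $d_1\ge D$, and put $d_{i+1}=T\bigl(2^{2^{2^{2^{d_i}}}}\bigr)$ for $i\ge1$. Then for every $i\ge 1$ there is a network size $n$ with $d_i+1\le n\le d_{i+1}$ such that, when the algorithm runs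 on $n$ devices, each device $s$ has the following property with probability at least $1/2$: for every $1\le j\le i$, the device $s$ spends at least one unit of energy during the slots $d_j,\dots,d_{j+1}-1$. -/

import Mathlib

open scoped ENNReal

universe u

noncomputable section

namespace RadioNetwork

/-- What a device may do in one time slot. -/
inductive Action (M : Type u) : Type u
  | idle : Action M
  | listen : Action M
  | transmit (m : M) : Action M

/-- What a device may perceive at the end of a time slot (`nothing`: no signal at all). -/
inductive Signal (M : Type u) : Type u
  | nothing : Signal M
  | silence : Signal M
  | noise : Signal M
  | message (m : M) : Signal M

/-- The four collision-detection models. -/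
inductive CDModel
  | strongCD
  | senderCD
  | receiverCD
  | noCD

variable {M : Type u} {Out : Type} {n : ℕ}

/-- The message sent by an action, if there is one. -/
def Action.sent : Action M → Option M
  | .transmit m => some m
  | _ => none

/-- The action costs one unit of energy, i.e. it is not `idle`. -/
def Action.Costs : Action M → Prop
  | .idle => False
  | _ => True

/-- The true status of the channel in a slot with actions `a`: silence, a message or a collision. -/
def channel (a : Fin n → Action M) : Signal M :=
  match (List.ofFn a).filterMap Action.sent with
  | [] => .silence
  | [m] => .message m
  | _ => .noise

/-- Without collision detection a collision is perceived as silence. -/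
def Signal.blur : Signal M → Signal M
  | .noise => .silence
  | s => s

/-- What a device that performed a given action perceives when the channel status is `s`. -/
def CDModel.perceive : CDModel → Action M → Signal M → Signal M
  | _, .idle, _ => .nothing
  | .strongCD, .listen, s => s
  | .receiverCD, .listen, s => s
  | .senderCD, .listen, s => s.blur
  | .noCD, .listen, s => s.blur
  | .strongCD, .transmit _, s => s
  | .senderCD, .transmit _, s => s.blur
  | .receiverCD, .transmit _, _ => .nothing
  | .noCD, .transmit _, _ => .nothing

/-- The state of a device: the list of its actions and perceived signals, in chronological order.
The entry at position `k` belongs to time slot `k`; slots are numbered from `0`. -/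
abbrev History (M : Type u) : Type u := List (Action M × Signal M)

/-- A randomized algorithm, run by all devices alike: `output h = some o` says that a device
terminates with output `o` on reaching the state `h`; in a non-terminal state `h` the next action
is drawn from `act h`. -/
structure Algorithm (M : Type u) (Out : Type) where
  output : History M → Option Out
  act : History M → PMF (Action M)

/-- The law of a family of independent draws. -/
def independent {α : Type u} : (n : ℕ) → (Fin n → PMF α) → PMF (Fin n → α)
  | 0, _ => PMF.pure Fin.elim0
  | n + 1, p =>
      (p 0).bind fun a =>
        (independent n fun i => p i.succ).map fun f => (Fin.cons a f : Fin (n + 1) → α)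

/-- The law of the action in state `h`; a terminated device does nothing. -/
def Algorithm.action (A : Algorithm M Out) (h : History M) : PMF (Action M) :=
  if (A.output h).isSome then PMF.pure .idle else A.act h

/-- The state after a slot in which the devices perform the actions `a`.
The state of a terminated device no longer changes. -/
def Algorithm.advance (A : Algorithm M Out) (model : CDModel)
    (H : Fin n → History M) (a : Fin n → Action M) (i : Fin n) : History M :=
  if (A.output (H i)).isSome then H i
  else H i ++ [(a i, model.perceive (a i) (channel a))]

/-- The joint law of the states of `n` devices after `t` time slots. -/
def Algorithm.exec (A : Algorithm M Out) (model : CDModel) (n : ℕ) : ℕ → PMF (Fin n → History M)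
  | 0 => PMF.pure fun _ => []
  | t + 1 => (A.exec model n t).bind fun H =>
      (independent n fun i => A.action (H i)).map (A.advance model H)

/-- The probability of an event. -/
def prob {α : Type u} (p : PMF α) (S : Set α) : ℝ≥0∞ := p.toOuterMeasure S

/-- The device with history `h` transmits in slot `k`. -/
def TransmitsAt (h : History M) (k : ℕ) : Prop := ∃ m s, h[k]? = some (.transmit m, s)

/-- The device with history `h` listens in slot `k`. -/
def ListensAt (h : History M) (k : ℕ) : Prop := ∃ s, h[k]? = some (.listen, s)

/-- The device with history `h` spends a unit of energy in slot `k`. -/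
def SpendsAt (h : History M) (k : ℕ) : Prop := ∃ e, h[k]? = some e ∧ e.1.Costs

open Classical in
/-- The total energy spent in a history. -/
def energy (h : History M) : ℕ := h.countP fun e => decide e.1.Costs

/-- Outputs in leader election. -/
inductive Role
  | leader
  | follower

/-- The problems considered; `κ` is the approximation factor of approximate counting. -/
inductive Problem
  | approximateCounting (κ : ℝ) (hκ : 1 ≤ κ)
  | leaderElection
  | contentionResolution

/-- The outputs of a problem. -/
def Problem.Output : Problem → Type
  | .approximateCounting _ _ => ℝ
  | .leaderElection => Role
  | .contentionResolution => Unit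

/-- `P.Solved out H`: all `n` devices have terminated, with histories `H` and outputs `out`,
and have solved the problem.
* Approximate counting: all devices agree on an estimate within a factor `κ` of `n`.
* Leader election: one device is the leader and all others are followers; in the last slot
  the leader transmits and every follower listens.
* Contention resolution: every device has been the only transmitter in some slot. -/
def Problem.Solved {n : ℕ} : (P : Problem) → (Fin n → Option P.Output) → (Fin n → History M) → Prop
  | .approximateCounting κ _, out, _ =>
      ∃ est : ℝ, (n : ℝ) / κ ≤ est ∧ est ≤ κ * n ∧ ∀ i, out i = some est
  | .leaderElection, out, H =>
      ∃ ℓ : Fin n, out ℓ = some Role.leader ∧ (∀ i, i ≠ ℓ → out i = some Role.follower) ∧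
        ∃ k, (∀ i, (H i).length = k + 1) ∧ TransmitsAt (H ℓ) k ∧ ∀ i, i ≠ ℓ → ListensAt (H i) k
  | .contentionResolution, out, H =>
      ∀ i, out i = some () ∧ ∃ k, TransmitsAt (H i) k ∧ ∀ j, j ≠ i → ¬ TransmitsAt (H j) k

/-- The profile of states `H` solves the problem `P` that `A` is designed for. -/
def Algorithm.Success {P : Problem} (A : Algorithm M P.Output) (H : Fin n → History M) : Prop :=
  P.Solved (fun i => A.output (H i)) H

/-- On any `n ≥ 2` devices, `A` solves `P` within `T n` slots, except with probability at most
`1 / n`. -/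
def Algorithm.SolvesInTime {P : Problem} (A : Algorithm M P.Output) (model : CDModel)
    (T : ℕ → ℕ) : Prop :=
  ∀ n : ℕ, 2 ≤ n → prob (A.exec model n (T n)) {H | ¬ A.Success H} ≤ 1 / (n : ℝ≥0∞)

/-- On any `n ≥ 2` devices, `A` solves `P` within `T n` slots and with at most `E n` units of energy
per device, except with probability at most `1 / n`. A failed execution may go on forever and use
any amount of energy. -/
def Algorithm.SolvesInTimeEnergy {P : Problem} (A : Algorithm M P.Output) (model : CDModel)
    (T E : ℕ → ℕ) : Prop :=
  ∀ n : ℕ, 2 ≤ n →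
    prob (A.exec model n (T n)) {H | ¬ (A.Success H ∧ ∀ i, energy (H i) ≤ E n)} ≤ 1 / (n : ℝ≥0∞)

/-- The tower of `α` twos with `x` on top. -/
def tower (α x : ℕ) : ℕ := (fun y => 2 ^ y)^[α] x

/-- The iterated logarithm: how often `log₂` has to be applied to get from `x` to at most `1`. -/
def logStar (x : ℝ) : ℕ := sInf {k : ℕ | (Real.logb 2)^[k] x ≤ 1}

/-- The checkpoints (numbered from `0`) for the time bound `T`, with first checkpoint `d₁`. -/
def checkpoint (T : ℕ → ℕ) (d₁ : ℕ) : ℕ → ℕ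
  | 0 => d₁
  | i + 1 => T (2 ^ 2 ^ 2 ^ 2 ^ checkpoint T d₁ i)

/-- Energy lower bound `Ω(log* n)` with constant `c`, in Sender-CD and in No-CD, for all algorithms
for `P` with running time at most `F n`: if `E n` bounds the energy, then the maximum of `E n`
over all network sizes `n ≤ N` is at least `c * log* N`, as soon as `N` is large. -/
def LogStarEnergyBound (c : ℝ) (P : Problem) (F : ℕ → ℕ) : Prop :=
  ∃ N₀ : ℕ, ∀ (M : Type u) (model : CDModel), (model = .senderCD ∨ model = .noCD) →
    ∀ (A : Algorithm M P.Output) (T E : ℕ → ℕ), (∀ n, 1 ≤ n → T n ≤ F n) →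
      A.SolvesInTimeEnergy model T E →
        ∀ N : ℕ, N₀ ≤ N → ∃ n, 2 ≤ n ∧ n ≤ N ∧ c * (logStar N : ℝ) ≤ (E n : ℝ)

end RadioNetwork

end

open RadioNetwork

/-!
Compare a network of `n` devices with `n` independent lone devices that always hear silence,
coupled so that a device draws the same action in both as long as its two states agree. In both
models a device learns nothing in a slot unless exactly one device transmits. So if no slot before
`d` has a single transmitter among the lone devices, the two agree up to slot `d`, and a device
that from then on rests until slot `t` has the same state in both.

If a lone device transmits in a given slot with probability `p`, then exactly one of `n` of them
does so with probability at most `n * p * (1 - p) ^ (n - 1)`. Along `n = 2 ^ k` this is at most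
`2 * (1 - p) ^ (n / 2) - 2 * (1 - p) ^ n`, so the sum over all `k` is at most `2`. Hence among any
`2 * d ^ 2` consecutive values of `k` there is one for which, with probability at least
`1 - 1 / d`, no slot before `d` has a single transmitter.

In a network of such a quiet size `n ≥ d` a device that rests from slot `d` until slot `t ≥ T n`
decides as a lone device does. In leader election and contention resolution this contradicts
success, since every device must spend energy in a slot with a single transmitter; in approximate
counting its output would have to fit two quiet sizes whose quotient exceeds `κ ^ 2`. Therefore a
lone device rests from `d` until `t` with probability at most `4 / d`. As the checkpoints at least
double, a union bound over the intervals between them transfers this to a network of quiet size.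
For time bounds given by a tower of exponentials the checkpoints themselves grow like towers of
linearly increasing height, and inverting them yields `log*`.
-/

namespace RadioNetwork

section Prob

variable {α β : Type u} {p : PMF α} {S : Set α}

theorem prob_mono_of_mem_support {S' : Set α} (h : ∀ x ∈ p.support, x ∈ S → x ∈ S') :
    prob p S ≤ prob p S' :=
  p.toOuterMeasure_mono fun x hx => h x hx.2 hx.1

theorem prob_union_le (p : PMF α) (S S' : Set α) : prob p (S ∪ S') ≤ prob p S + prob p S' :=
  MeasureTheory.measure_union_le S S'

theorem prob_exists_le {ι : Type*} (p : PMF α) (J : Finset ι) (S : ι → Set α) :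
    prob p {x | ∃ j ∈ J, x ∈ S j} ≤ ∑ j ∈ J, prob p (S j) := by
  have setOf_exists : {x | ∃ j ∈ J, x ∈ S j} = ⋃ j ∈ J, S j := by
    ext x
    simp only [Set.mem_ofPred_eq, Set.mem_iUnion, exists_prop]
  rw [setOf_exists]
  exact MeasureTheory.measure_biUnion_finset_le J S

theorem prob_map (f : α → β) (p : PMF α) (S : Set β) : prob (p.map f) S = prob p (f ⁻¹' S) :=
  p.toOuterMeasure_map_apply f S

theorem prob_add_prob_compl (p : PMF α) (S : Set α) : prob p S + prob p Sᶜ = 1 := by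
  classical
  simp only [prob, PMF.toOuterMeasure_apply, ← ENNReal.tsum_add]
  simp

theorem prob_le_one (p : PMF α) (S : Set α) : prob p S ≤ 1 :=
  le_self_add.trans_eq (prob_add_prob_compl p S)

theorem prob_eq_one_sub_prob_compl (p : PMF α) (S : Set α) : prob p S = 1 - prob p Sᶜ :=
  ENNReal.eq_sub_of_add_eq ((prob_le_one p Sᶜ).trans_lt ENNReal.one_lt_top).ne
    (prob_add_prob_compl p S)

theorem prob_bind (p : PMF α) (K : α → PMF β) (S : Set β) :
    prob (p.bind K) S = ∑' x, p x * prob (K x) S :=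
  p.toOuterMeasure_bind_apply K S

theorem prob_bind_le_of_mem_support {K : α → PMF β} {S' : Set β}
    (h : ∀ x, ∀ y ∈ (K x).support, y ∈ S' → x ∈ S) : prob (p.bind K) S' ≤ prob p S := by
  rw [prob_bind, prob, p.toOuterMeasure_apply]
  refine ENNReal.tsum_le_tsum fun x => ?_
  by_cases hx : x ∈ S
  · rw [Set.indicator_of_mem hx]
    exact mul_le_of_le_one_right' (prob_le_one (K x) S')
  · have : prob (K x) S' = 0 :=
      ((K x).toOuterMeasure_apply_eq_zero_iff S').2 <|
        Set.disjoint_left.2 fun y hy hy' => hx (h x y hy hy')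
    simp [this]

end Prob

section Independent

variable {α β : Type u} {n : ℕ}

theorem independent_pure (x : Fin n → α) :
    (independent n fun i => PMF.pure (x i)) = PMF.pure x := by
  induction n with
  | zero => exact congrArg PMF.pure (Subsingleton.elim _ _)
  | succ n ih =>
    simp only [independent, PMF.pure_bind, ih, PMF.pure_map]
    exact congrArg PMF.pure (Fin.cons_self_tail x)

theorem independent_map (p : Fin n → PMF α) (f : Fin n → α → β) :
    (independent n p).map (fun x i => f i (x i)) = independent n fun i => (p i).map (f i) := by
  induction n with
  | zero => exact (PMF.pure_map ..).trans (congrArg PMF.pure (Subsingleton.elim _ _))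
  | succ n ih =>
    simp only [independent, PMF.map_bind, PMF.bind_map, PMF.map_comp, ← ih, Function.comp_def]
    congr! 5 with a x i
    cases i using Fin.cases <;> rfl

theorem independent_bind (p : Fin n → PMF α) (q : Fin n → α → PMF β) :
    ((independent n p).bind fun x => independent n fun i => q i (x i)) =
      independent n fun i => (p i).bind (q i) := by
  induction n with
  | zero => simp [independent]
  | succ n ih =>
    simp only [independent, PMF.bind_bind, PMF.bind_map, PMF.map_bind, ← ih, Function.comp_def,
      Fin.cons_zero, Fin.cons_succ]
    congr! 2 with a
    rw [PMF.bind_comm]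

theorem independent_map_apply (p : Fin n → PMF α) (s : Fin n) :
    (independent n p).map (fun x => x s) = p s := by
  induction n with
  | zero => exact s.elim0
  | succ n ih =>
    simp only [independent, PMF.map_bind, PMF.map_comp, Function.comp_def]
    cases s using Fin.cases with
    | zero =>
      exact (congrArg _ (funext fun a => PMF.map_const _ a)).trans (PMF.bind_pure _)
    | succ s => simp [ih, PMF.bind_const]

theorem mem_support_of_mem_support_independent {p : Fin n → PMF α} {x : Fin n → α}
    (hx : x ∈ (independent n p).support) (i : Fin n) : x i ∈ (p i).support := by
  rw [← independent_map_apply p i, PMF.mem_support_map_iff]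
  exact ⟨x, hx, rfl⟩

theorem prob_independent_pi (p : Fin n → PMF α) (S : Fin n → Set α) :
    prob (independent n p) {x | ∀ i, x i ∈ S i} = ∏ i, prob (p i) (S i) := by
  induction n with
  | zero => simp [independent, prob, Subsingleton.elim default Fin.elim0]
  | succ n ih =>
    have prob_cons (a : α) : prob (independent n fun i => p i.succ)
        ((fun x => (Fin.cons a x : Fin (n + 1) → α)) ⁻¹' {x | ∀ i, x i ∈ S i}) =
        (S 0).indicator (fun _ => ∏ i : Fin n, prob (p i.succ) (S i.succ)) a := by
      by_cases ha : a ∈ S 0 <;>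
        simp only [Set.preimage_ofPred_eq, Fin.forall_fin_succ, Fin.cons_zero, ha, Fin.cons_succ,
          true_and, false_and, ih, Set.indicator_of_mem, Set.indicator_of_notMem, not_false_iff]
      exact MeasureTheory.measure_empty
    simp only [independent, prob_bind, prob_map, prob_cons, Fin.prod_univ_succ]
    rw [prob, PMF.toOuterMeasure_apply, ← ENNReal.tsum_mul_right]
    refine tsum_congr fun a => ?_
    by_cases ha : a ∈ S 0 <;> simp [ha]

end Independent

section ExactlyOne

theorem mul_pow_add_pow_succ_le {R : Type*} [CommSemiring R] [PartialOrder R] [IsOrderedRing R]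
    [CanonicallyOrderedAdd R] (p x : R) (r : ℕ) :
    (r + 1) * p * x ^ r + x ^ (r + 1) ≤ (p + x) ^ (r + 1) := by
  induction r with
  | zero => simp
  | succ r ih =>
    calc ((r + 1 : ℕ) + 1) * p * x ^ (r + 1) + x ^ (r + 2)
      _ ≤ ((r + 1) * p * x ^ r + x ^ (r + 1)) * (p + x) := by
          refine le_iff_exists_add.2 ⟨(r + 1) * p ^ 2 * x ^ r, ?_⟩
          push_cast; ring
      _ ≤ (p + x) ^ (r + 1) * (p + x) := by gcongr
      _ = (p + x) ^ (r + 2) := (pow_succ ..).symm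

variable {α : Type u}

theorem prob_existsUnique_mem_le (n : ℕ) (q : PMF α) (S : Set α) :
    prob (independent n fun _ => q) {x | ∃! i, x i ∈ S} ≤ n * prob q S * prob q Sᶜ ^ (n - 1) := by
  classical
  calc prob (independent n fun _ => q) {x | ∃! i, x i ∈ S}
    _ ≤ prob (independent n fun _ => q)
          {x | ∃ i ∈ Finset.univ, x ∈ {x | ∀ j, x j ∈ Function.update (fun _ => Sᶜ) i S j}} := by
        refine prob_mono_of_mem_support fun x _ ⟨i, hi, hne⟩ => ⟨i, Finset.mem_univ i, fun j => ?_⟩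
        rcases eq_or_ne j i with rfl | hj
        · simpa using hi
        · simpa [hj] using mt (hne j) hj
    _ ≤ ∑ i : Fin n, ∏ j, prob q (Function.update (fun _ => Sᶜ) i S j) := by
        simpa only [prob_independent_pi] using prob_exists_le (independent n fun _ => q)
          Finset.univ fun i => {x | ∀ j, x j ∈ Function.update (fun _ => Sᶜ) i S j}
    _ = n * prob q S * prob q Sᶜ ^ (n - 1) := by
        simp only [Function.apply_update (fun _ => prob q),
          Finset.prod_update_of_mem (Finset.mem_univ _), Finset.prod_const,
          Finset.card_sdiff, Finset.inter_univ, Finset.card_univ, Finset.card_singleton,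
          Fintype.card_fin, Finset.sum_const, nsmul_eq_mul, mul_assoc]

theorem prob_existsUnique_mem_add_le (m : ℕ) (q : PMF α) (S : Set α) :
    prob (independent (2 * m) fun _ => q) {x | ∃! i, x i ∈ S} + 2 * prob q Sᶜ ^ (2 * m) ≤
      2 * prob q Sᶜ ^ m := by
  refine (add_le_add_left (prob_existsUnique_mem_le (2 * m) q S) _).trans ?_
  cases m with
  | zero => simp
  | succ m =>
    have bernoulli : (m + 1) * prob q S * prob q Sᶜ ^ m + prob q Sᶜ ^ (m + 1) ≤ 1 := by
      simpa only [prob_add_prob_compl, one_pow] using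
        mul_pow_add_pow_succ_le (prob q S) (prob q Sᶜ) m
    calc (2 * (m + 1) : ℕ) * prob q S * prob q Sᶜ ^ (2 * (m + 1) - 1) +
          2 * prob q Sᶜ ^ (2 * (m + 1))
      _ = 2 * prob q Sᶜ ^ (m + 1) *
            ((m + 1) * prob q S * prob q Sᶜ ^ m + prob q Sᶜ ^ (m + 1)) := by
          rw [show 2 * (m + 1) - 1 = (m + 1) + m by omega]
          push_cast; ring
      _ ≤ 2 * prob q Sᶜ ^ (m + 1) := mul_le_of_le_one_right' bernoulli

theorem sum_prob_existsUnique_mem_le (q : PMF α) (S : Set α) (a K : ℕ) :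
    ∑ k ∈ Finset.range K, prob (independent (2 ^ (a + k + 1)) fun _ => q) {x | ∃! i, x i ∈ S} +
      2 * prob q Sᶜ ^ 2 ^ (a + K) ≤ 2 := by
  induction K with
  | zero => simpa using mul_le_of_le_one_right' (pow_le_one' (prob_le_one q Sᶜ) _)
  | succ K ih =>
    refine le_trans ?_ ih
    rw [Finset.sum_range_succ, add_assoc, ← add_assoc a, pow_succ']
    gcongr
    exact prob_existsUnique_mem_add_le (2 ^ (a + K)) q S

theorem exists_prob_existsUnique_mem_le {ι : Type*} (q : PMF α) {J : Finset ι} (hJ : J.Nonempty)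
    (S : ι → Set α) (a : ℕ) {K : ℕ} (hK : K ≠ 0) :
    ∃ k, a < k ∧ k ≤ a + 2 * J.card * K ∧
      prob (independent (2 ^ k) fun _ => q) {x | ∃ j ∈ J, ∃! i, x i ∈ S j} ≤ (K : ℝ≥0∞)⁻¹ := by
  let f (k : ℕ) := prob (independent (2 ^ k) fun _ => q) {x | ∃ j ∈ J, ∃! i, x i ∈ S j}
  have sum_le (L : ℕ) : ∑ k ∈ Finset.range L, f (a + k + 1) ≤ 2 * J.card :=
    calc ∑ k ∈ Finset.range L, f (a + k + 1)
      _ ≤ ∑ k ∈ Finset.range L, ∑ j ∈ J,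
            prob (independent (2 ^ (a + k + 1)) fun _ => q) {x | ∃! i, x i ∈ S j} :=
          Finset.sum_le_sum fun k _ => prob_exists_le _ J _
      _ = ∑ j ∈ J, ∑ k ∈ Finset.range L,
            prob (independent (2 ^ (a + k + 1)) fun _ => q) {x | ∃! i, x i ∈ S j} :=
          Finset.sum_comm
      _ ≤ ∑ j ∈ J, 2 :=
          Finset.sum_le_sum fun j _ => le_self_add.trans (sum_prob_existsUnique_mem_le q (S j) a L)
      _ = 2 * J.card := by rw [Finset.sum_const, nsmul_eq_mul, mul_comm]
  by_contra! h
  refine (sum_le (2 * J.card * K)).not_gt ?_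
  calc (2 * J.card : ℝ≥0∞)
    _ = ∑ _ ∈ Finset.range (2 * J.card * K), (K : ℝ≥0∞)⁻¹ := by
        rw [Finset.sum_const, Finset.card_range, nsmul_eq_mul, Nat.cast_mul, mul_assoc,
          ENNReal.mul_inv_cancel (by exact_mod_cast hK) (ENNReal.natCast_ne_top K), mul_one,
          Nat.cast_mul, Nat.cast_ofNat]
    _ < ∑ k ∈ Finset.range (2 * J.card * K), f (a + k + 1) := by
        refine ENNReal.sum_lt_sum_of_nonempty ?_ fun _ hk => ?_
        · simp [hJ.card_ne_zero, hK]
        · exact h _ (by omega) (by have := Finset.mem_range.1 hk; omega)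

end ExactlyOne

section Channel

variable {M : Type u} {n : ℕ} {model : CDModel}

theorem countP_ofFn_eq_card {α : Type*} (f : Fin n → α) (P : α → Bool) :
    (List.ofFn f).countP P = (Finset.univ.filter fun i => P (f i)).card := by
  have ofFn_eq_map : (List.ofFn f : Multiset α) = Finset.univ.val.map f := (Fin.univ_val_map f).symm
  have := congrArg (Multiset.countP fun x => (P x : Prop)) ofFn_eq_map
  simp only [Multiset.coe_countP, Bool.decide_eq_true, Multiset.countP_map] at this
  exact this

theorem blur_channel {a : Fin n → Action M} (ha : ¬ ∃! i, (a i).sent.isSome) :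
    (channel a).blur = .silence := by
  unfold channel
  split
  · rfl
  · next m hm =>
    refine absurd ?_ ha
    have := congrArg List.length hm
    rw [List.length_filterMap_eq_countP, countP_ofFn_eq_card, List.length_singleton,
      Finset.card_eq_one_iff_existsUnique] at this
    simpa using this
  · rfl

theorem perceive_eq_of_blur_eq_silence (hm : model = .senderCD ∨ model = .noCD) {s : Signal M}
    (hs : s.blur = .silence) (a : Action M) :
    model.perceive a s = model.perceive a .silence := by
  rcases hm with rfl | rfl <;> cases a <;> simp only [CDModel.perceive, hs] <;> rfl

theorem perceive_idle (s : Signal M) : model.perceive .idle s = .nothing := by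
  cases model <;> rfl

end Channel

section Histories

variable {M : Type u} {n d t : ℕ}

/-- Exactly one device transmits in slot `k`. -/
def SingleAt (H : Fin n → History M) (k : ℕ) : Prop := ∃! i, TransmitsAt (H i) k

/-- In no slot before slot `d` exactly one device transmits. -/
def Quiet (d : ℕ) (H : Fin n → History M) : Prop := ∀ k < d, ¬ SingleAt H k

/-- The device spends no energy in the slots `d, …, t - 1`. -/
def Rests (d t : ℕ) (h : History M) : Prop := ∀ k, d ≤ k → k < t → ¬ SpendsAt h k

theorem TransmitsAt.spendsAt {h : History M} {k : ℕ} (hk : TransmitsAt h k) : SpendsAt h k :=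
  let ⟨_, _, h⟩ := hk
  ⟨_, h, trivial⟩

theorem ListensAt.spendsAt {h : History M} {k : ℕ} (hk : ListensAt h k) : SpendsAt h k :=
  let ⟨_, h⟩ := hk
  ⟨_, h, trivial⟩

theorem ListensAt.not_transmitsAt {h : History M} {k : ℕ} (hk : ListensAt h k) :
    ¬ TransmitsAt h k := by
  obtain ⟨s, hs⟩ := hk
  rintro ⟨m, s', hs'⟩
  simp [hs] at hs'

theorem SpendsAt.lt_length {h : History M} {k : ℕ} (hk : SpendsAt h k) : k < h.length :=
  let ⟨_, he, _⟩ := hk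
  (List.getElem?_eq_some_iff.1 he).1

theorem Quiet.mono {t : ℕ} {H : Fin n → History M} (hH : Quiet t H) (hd : d ≤ t) : Quiet d H :=
  fun k hk => hH k (hk.trans_le hd)

theorem Rests.mono_right {e : ℕ} {h : History M} (hh : Rests d t h) (he : e ≤ t) : Rests d e h :=
  fun k hd hk => hh k hd (hk.trans_le he)

theorem Rests.of_prefix {h h' : History M} (hr : Rests d t h') (hh : h <+: h') : Rests d t h := by
  obtain ⟨h'', rfl⟩ := hh
  rintro k hd ht ⟨e, he, hc⟩
  exact hr k hd ht ⟨e, List.getElem?_append_left (List.getElem?_eq_some_iff.1 he).1 ▸ he, hc⟩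

theorem getElem?_eq_of_take_eq {α : Type*} {l l' : List α} (h : l.take t = l'.take t) {k : ℕ}
    (hk : k < t) : l[k]? = l'[k]? := by
  rw [← List.getElem?_take_of_lt hk, h, List.getElem?_take_of_lt hk]

theorem quiet_congr {H H' : Fin n → History M} (h : ∀ i, (H i).take t = (H' i).take t) :
    Quiet t H ↔ Quiet t H' := by
  refine forall₂_congr fun k hk => ?_
  simp only [SingleAt, TransmitsAt, getElem?_eq_of_take_eq (h _) hk]

theorem rests_congr {h h' : History M} (hh : h.take t = h'.take t) :
    Rests d t h ↔ Rests d t h' := by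
  refine forall₂_congr fun k _ => forall_congr' fun hk => ?_
  simp only [SpendsAt, getElem?_eq_of_take_eq hh hk]

end Histories

section Step

variable {M : Type u} {Out : Type} {A : Algorithm M Out} {model : CDModel} {n d t : ℕ}
  {h : History M} {a : Action M} {s : Signal M}

/-- The state of a device after a slot in which it performs the action `a` and the status of the
channel is `s`. -/
def Algorithm.step (A : Algorithm M Out) (model : CDModel) (s : Signal M) (h : History M)
    (a : Action M) : History M :=
  if (A.output h).isSome then h else h ++ [(a, model.perceive a s)]

/-- `h` is a possible state after `t` slots, as far as its length is concerned: it has an entry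
for every slot until termination. -/
def Algorithm.IsStateAt (A : Algorithm M Out) (t : ℕ) (h : History M) : Prop :=
  h.length ≤ t ∧ (¬ (A.output h).isSome → h.length = t)

theorem Algorithm.step_of_isSome (ho : (A.output h).isSome) : A.step model s h a = h := if_pos ho

theorem Algorithm.step_of_not_isSome (ho : ¬ (A.output h).isSome) :
    A.step model s h a = h ++ [(a, model.perceive a s)] := if_neg ho

theorem Algorithm.prefix_step : h <+: A.step model s h a := by
  unfold Algorithm.step
  split_ifs
  exacts [List.prefix_rfl, List.prefix_append ..]

theorem Algorithm.IsStateAt.step (hh : A.IsStateAt t h) :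
    A.IsStateAt (t + 1) (A.step model s h a) := by
  by_cases ho : (A.output h).isSome
  · rw [Algorithm.step_of_isSome ho]
    exact ⟨hh.1.trans t.le_succ, absurd ho⟩
  · simp [Algorithm.step_of_not_isSome ho, IsStateAt, hh.2 ho]

theorem Algorithm.IsStateAt.take_step (hh : A.IsStateAt t h) (hd : d ≤ t) :
    (A.step model s h a).take d = h.take d := by
  by_cases ho : (A.output h).isSome
  · rw [Algorithm.step_of_isSome ho]
  · rw [Algorithm.step_of_not_isSome ho, List.take_append_of_le_length (hd.trans_eq (hh.2 ho).symm)]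

theorem Algorithm.IsStateAt.getElem?_step (hh : A.IsStateAt t h) :
    (A.step model s h a)[t]? =
      if (A.output h).isSome then none else some (a, model.perceive a s) := by
  split_ifs with ho
  · rw [Algorithm.step_of_isSome ho, List.getElem?_eq_none hh.1]
  · rw [Algorithm.step_of_not_isSome ho, ← hh.2 ho, List.getElem?_concat_length]

theorem Algorithm.eq_idle_of_mem_support_action (ha : a ∈ (A.action h).support)
    (ho : (A.output h).isSome) : a = .idle := by
  rwa [Algorithm.action, if_pos ho, PMF.mem_support_pure_iff] at ha

theorem Algorithm.IsStateAt.transmitsAt_step (hh : A.IsStateAt t h)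
    (ha : a ∈ (A.action h).support) :
    TransmitsAt (A.step model s h a) t ↔ a.sent.isSome := by
  rw [TransmitsAt, hh.getElem?_step]
  split_ifs with ho
  · simp [eq_idle_of_mem_support_action ha ho, Action.sent]
  · cases a <;> simp [Action.sent]

theorem Algorithm.IsStateAt.step_eq_step_of_not_spendsAt (hh : A.IsStateAt t h)
    (hs : ¬ SpendsAt (A.step model s h a) t) (s' : Signal M) :
    A.step model s h a = A.step model s' h a := by
  by_cases ho : (A.output h).isSome
  · rw [Algorithm.step_of_isSome ho, Algorithm.step_of_isSome ho]
  · have : a = .idle := by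
      rw [SpendsAt, hh.getElem?_step, if_neg ho] at hs
      cases a <;> simp_all [Action.Costs]
    simp only [Algorithm.step, this, perceive_idle]

end Step

section Coupling

variable {α : Type u}

open Classical in
/-- A law on pairs with marginals `p` and `q` under which the components agree if `p = q`. -/
noncomputable def diagonalCoupling (p q : PMF α) : PMF (α × α) :=
  if p = q then p.map fun a => (a, a) else p.bind fun a => q.map fun b => (a, b)

theorem diagonalCoupling_map_fst (p q : PMF α) : (diagonalCoupling p q).map Prod.fst = p := by
  unfold diagonalCoupling
  split_ifs
  · rw [PMF.map_comp]
    exact PMF.map_id p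
  · simp only [PMF.map_bind, PMF.map_comp, Function.comp_def]
    exact (congrArg _ (funext fun a => PMF.map_const q a)).trans (PMF.bind_pure p)

theorem diagonalCoupling_map_snd (p q : PMF α) : (diagonalCoupling p q).map Prod.snd = q := by
  unfold diagonalCoupling
  split_ifs with h
  · rw [PMF.map_comp, ← h]
    exact PMF.map_id p
  · simp only [PMF.map_bind, PMF.map_comp, Function.comp_def]
    exact (PMF.bind_const p _).trans (PMF.map_id q)

theorem independent_diagonalCoupling_map_fst {n : ℕ} (p q : Fin n → PMF α) :
    (independent n fun i => diagonalCoupling (p i) (q i)).map (fun b i => (b i).1) =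
      independent n p :=
  (independent_map _ fun _ => Prod.fst).trans <|
    congrArg _ <| funext fun i => diagonalCoupling_map_fst (p i) (q i)

theorem independent_diagonalCoupling_map_snd {n : ℕ} (p q : Fin n → PMF α) :
    (independent n fun i => diagonalCoupling (p i) (q i)).map (fun b i => (b i).2) =
      independent n q :=
  (independent_map _ fun _ => Prod.snd).trans <|
    congrArg _ <| funext fun i => diagonalCoupling_map_snd (p i) (q i)

theorem mem_support_snd_of_mem_support_diagonalCoupling {p q : PMF α} {b : α × α}
    (hb : b ∈ (diagonalCoupling p q).support) : b.2 ∈ q.support := by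
  rw [← diagonalCoupling_map_snd p q, PMF.mem_support_map_iff]
  exact ⟨b, hb, rfl⟩

theorem fst_eq_snd_of_mem_support_diagonalCoupling {p : PMF α} {b : α × α}
    (hb : b ∈ (diagonalCoupling p p).support) : b.1 = b.2 := by
  rw [diagonalCoupling, if_pos rfl, PMF.mem_support_map_iff] at hb
  obtain ⟨a, -, rfl⟩ := hb
  rfl

variable {M : Type u} {Out : Type} {A : Algorithm M Out} {model : CDModel} {n d t : ℕ}

/-- The law of the state after `t` slots of a lone device that runs `A` and always hears silence,
even in the slots in which it transmits. -/
noncomputable def Algorithm.solo (A : Algorithm M Out) (model : CDModel) : ℕ → PMF (History M)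
  | 0 => PMF.pure []
  | t + 1 => (A.solo model t).bind fun h => (A.action h).map (A.step model .silence h)

/-- A joint law of the states of `n` devices in one network (first component) and of `n` lone
devices (second component): a device draws the same action in both as long as its two states
agree. -/
noncomputable def Algorithm.coupled (A : Algorithm M Out) (model : CDModel) (n : ℕ) :
    ℕ → PMF ((Fin n → History M) × (Fin n → History M))
  | 0 => PMF.pure (fun _ => [], fun _ => [])
  | t + 1 => (A.coupled model n t).bind fun X =>
      (independent n fun i => diagonalCoupling (A.action (X.1 i)) (A.action (X.2 i))).map fun b =>
        (A.advance model X.1 fun i => (b i).1, fun i => A.step model .silence (X.2 i) (b i).2)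

theorem Algorithm.coupled_map_fst (t : ℕ) :
    (A.coupled model n t).map Prod.fst = A.exec model n t := by
  induction t with
  | zero => exact PMF.pure_map ..
  | succ t ih =>
    simp only [coupled, exec, ← ih, PMF.map_bind, PMF.bind_map, PMF.map_comp, Function.comp_def]
    congr! 2 with X
    rw [← independent_diagonalCoupling_map_fst (fun i => A.action (X.1 i))
        fun i => A.action (X.2 i),
      PMF.map_comp]
    rfl

theorem Algorithm.coupled_map_snd (t : ℕ) :
    (A.coupled model n t).map Prod.snd = independent n fun _ => A.solo model t := by
  induction t with
  | zero => simp [coupled, solo, independent_pure, PMF.pure_map]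
  | succ t ih =>
    simp only [coupled, solo, PMF.map_bind, PMF.map_comp, Function.comp_def]
    rw [← independent_bind, ← ih, PMF.bind_map]
    congr! 2 with X
    rw [Function.comp_apply, ← independent_map,
      ← independent_diagonalCoupling_map_snd (fun i => A.action (X.1 i)) fun i => A.action (X.2 i),
      PMF.map_comp]
    rfl

variable {X : (Fin n → History M) × (Fin n → History M)}

theorem Algorithm.exists_of_mem_support_coupled_succ
    (hX : X ∈ (A.coupled model n (t + 1)).support) :
    ∃ Y ∈ (A.coupled model n t).support, ∃ b : Fin n → Action M × Action M,
      (∀ i, b i ∈ (diagonalCoupling (A.action (Y.1 i)) (A.action (Y.2 i))).support) ∧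
      X = (A.advance model Y.1 fun i => (b i).1,
        fun i => A.step model .silence (Y.2 i) (b i).2) := by
  simp only [coupled, PMF.mem_support_bind_iff, PMF.mem_support_map_iff] at hX
  obtain ⟨Y, hY, b, hb, rfl⟩ := hX
  exact ⟨Y, hY, b, mem_support_of_mem_support_independent hb, rfl⟩

theorem Algorithm.isStateAt_of_mem_support_coupled (hX : X ∈ (A.coupled model n t).support)
    (i : Fin n) : A.IsStateAt t (X.1 i) ∧ A.IsStateAt t (X.2 i) := by
  induction t generalizing X with
  | zero =>
    rw [coupled, PMF.mem_support_pure_iff] at hX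
    subst hX
    simp [IsStateAt]
  | succ t ih =>
    obtain ⟨Y, hY, b, -, rfl⟩ := exists_of_mem_support_coupled_succ hX
    exact ⟨(ih hY).1.step, (ih hY).2.step⟩

theorem Algorithm.eq_of_quiet (hm : model = .senderCD ∨ model = .noCD)
    (hX : X ∈ (A.coupled model n t).support) (hq : Quiet t X.2) : X.1 = X.2 := by
  induction t generalizing X with
  | zero =>
    rw [coupled, PMF.mem_support_pure_iff] at hX
    rw [hX]
  | succ t ih =>
    obtain ⟨⟨H, G⟩, hY, b, hb, rfl⟩ := exists_of_mem_support_coupled_succ hX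
    have hG (i : Fin n) : A.IsStateAt t (G i) := (isStateAt_of_mem_support_coupled hY i).2
    obtain rfl : H = G := ih hY <|
      (quiet_congr fun i => (hG i).take_step le_rfl).1 (hq.mono t.le_succ)
    have same_action (i : Fin n) : (b i).1 = (b i).2 :=
      fst_eq_snd_of_mem_support_diagonalCoupling (hb i)
    have no_message : (channel fun i => (b i).2).blur = .silence := by
      refine blur_channel fun h => hq t t.lt_succ_self ?_
      simpa only [SingleAt, (hG _).transmitsAt_step
        (mem_support_snd_of_mem_support_diagonalCoupling (hb _))] using h
    funext i
    simp only [advance, Algorithm.step, same_action, perceive_eq_of_blur_eq_silence hm no_message]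

theorem Algorithm.take_eq_take_of_quiet (hm : model = .senderCD ∨ model = .noCD) (hd : d ≤ t)
    (hX : X ∈ (A.coupled model n t).support) (hq : Quiet d X.2) (i : Fin n) :
    (X.1 i).take d = (X.2 i).take d := by
  induction t, hd using Nat.le_induction generalizing X with
  | base => rw [eq_of_quiet hm hX hq]
  | succ t hd ih =>
    obtain ⟨Y, hY, b, -, rfl⟩ := exists_of_mem_support_coupled_succ hX
    have hs (i : Fin n) := isStateAt_of_mem_support_coupled hY i
    exact ((hs i).1.take_step hd).trans <|
      (ih hY ((quiet_congr fun i => (hs i).2.take_step hd).1 hq)).trans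
        ((hs i).2.take_step hd).symm

theorem Algorithm.eq_of_quiet_of_rests (hm : model = .senderCD ∨ model = .noCD) (hd : d ≤ t)
    (hX : X ∈ (A.coupled model n t).support) (hq : Quiet d X.2) {i : Fin n}
    (hr : Rests d t (X.1 i) ∨ Rests d t (X.2 i)) : X.1 i = X.2 i := by
  induction t, hd using Nat.le_induction generalizing X with
  | base => rw [eq_of_quiet hm hX hq]
  | succ t hd ih =>
    obtain ⟨⟨H, G⟩, hY, b, hb, rfl⟩ := exists_of_mem_support_coupled_succ hX
    have hs (i : Fin n) := isStateAt_of_mem_support_coupled hY i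
    have same_state : H i = G i :=
      ih hY ((quiet_congr fun i => (hs i).2.take_step hd).1 hq) <| hr.imp
        (fun h => (rests_congr ((hs i).1.take_step le_rfl)).1 (h.mono_right t.le_succ))
        (fun h => (rests_congr ((hs i).2.take_step le_rfl)).1 (h.mono_right t.le_succ))
    have same_action : (b i).1 = (b i).2 := by
      have := hb i
      simp only [same_state] at this
      exact fst_eq_snd_of_mem_support_diagonalCoupling this
    have hG := (hs i).2
    change A.step model _ (H i) (b i).1 = A.step model .silence (G i) (b i).2
    change Rests d (t + 1) (A.step model _ (H i) (b i).1) ∨ _ at hr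
    rw [same_state, same_action] at hr ⊢
    rcases hr with hr | hr
    · exact hG.step_eq_step_of_not_spendsAt (hr t hd t.lt_succ_self) _
    · exact (hG.step_eq_step_of_not_spendsAt (hr t hd t.lt_succ_self) _).symm

end Coupling

section Transfer

variable {M : Type u} {Out : Type} {A : Algorithm M Out} {model : CDModel} {n d e t t' : ℕ}

theorem Algorithm.prob_exec_antitone {S : Set (Fin n → History M)}
    (hS : ∀ H a, A.advance model H a ∈ S → H ∈ S) (ht : t ≤ t') :
    prob (A.exec model n t') S ≤ prob (A.exec model n t) S := by
  refine antitone_nat_of_succ_le (f := fun t => prob (A.exec model n t) S) (fun t => ?_) ht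
  refine prob_bind_le_of_mem_support fun H H' hH' h => ?_
  obtain ⟨a, -, rfl⟩ := (PMF.mem_support_map_iff ..).1 hH'
  exact hS H a h

theorem Algorithm.prob_exec_monotone {S : Set (Fin n → History M)}
    (hS : ∀ H a, H ∈ S → A.advance model H a ∈ S) (ht : t ≤ t') :
    prob (A.exec model n t) S ≤ prob (A.exec model n t') S := by
  rw [prob_eq_one_sub_prob_compl, prob_eq_one_sub_prob_compl _ S]
  exact tsub_le_tsub_left (prob_exec_antitone (fun H a => mt (hS H a)) ht) 1

theorem Algorithm.prob_solo_rests_antitone (ht : t ≤ t') :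
    prob (A.solo model t') {h | Rests d e h} ≤ prob (A.solo model t) {h | Rests d e h} := by
  refine antitone_nat_of_succ_le (f := fun t => prob (A.solo model t) {h | Rests d e h})
    (fun t => ?_) ht
  refine prob_bind_le_of_mem_support fun h h' hh' hr => ?_
  obtain ⟨a, -, rfl⟩ := (PMF.mem_support_map_iff ..).1 hh'
  exact hr.of_prefix prefix_step

theorem Algorithm.prob_exec_le_prob_solo {S S' : Set (Fin n → History M)}
    (h : ∀ X ∈ (A.coupled model n t).support, X.1 ∈ S → X.2 ∈ S') :
    prob (A.exec model n t) S ≤ prob (independent n fun _ => A.solo model t) S' := by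
  rw [← coupled_map_fst, ← coupled_map_snd, prob_map, prob_map]
  exact prob_mono_of_mem_support h

theorem Algorithm.prob_solo_le_prob_exec {S S' : Set (Fin n → History M)}
    (h : ∀ X ∈ (A.coupled model n t).support, X.2 ∈ S → X.1 ∈ S') :
    prob (independent n fun _ => A.solo model t) S ≤ prob (A.exec model n t) S' := by
  rw [← coupled_map_fst, ← coupled_map_snd, prob_map, prob_map]
  exact prob_mono_of_mem_support h

theorem Algorithm.prob_independent_solo (s : Fin n) (S : Set (History M)) :
    prob (independent n fun _ => A.solo model t) {G | G s ∈ S} = prob (A.solo model t) S := by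
  conv_rhs => rw [← independent_map_apply (fun _ => A.solo model t) s, prob_map]
  rfl

/-- Among `n` lone devices, with probability at least `1 - 1 / d` there is no slot before slot `d`
in which exactly one of them transmits (the states are those after `t` slots). In a network of this
size the first `d` slots tell a device nothing. -/
def Algorithm.IsQuietSize (A : Algorithm M Out) (model : CDModel) (d t n : ℕ) : Prop :=
  prob (independent n fun _ => A.solo model t) {G | ¬ Quiet d G} ≤ (d : ℝ≥0∞)⁻¹

theorem Algorithm.exists_isQuietSize (A : Algorithm M Out) (model : CDModel) (hd : d ≠ 0)
    (t a : ℕ) : ∃ k, a < k ∧ k ≤ a + 2 * d ^ 2 ∧ A.IsQuietSize model d t (2 ^ k) := by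
  obtain ⟨k, hak, hka, hk⟩ := exists_prob_existsUnique_mem_le (A.solo model t)
    (Finset.nonempty_range_iff.2 hd) (fun j => {h | TransmitsAt h j}) a hd
  refine ⟨k, hak, hka.trans_eq (by rw [Finset.card_range]; ring), ?_⟩
  refine (prob_mono_of_mem_support fun G _ hG => ?_).trans hk
  simpa [Quiet, SingleAt] using hG

theorem sq_le_two_pow {y : ℕ} (hy : 4 ≤ y) : y ^ 2 ≤ 2 ^ y := by
  induction y, hy using Nat.le_induction with
  | base => norm_num
  | succ y hy ih => rw [pow_succ 2 y]; nlinarith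

theorem two_mul_add_four_mul_sq_le {d : ℕ} (hd : 4 ≤ d) : 2 * d + 4 * d ^ 2 ≤ 2 ^ 2 ^ 2 ^ d := by
  have sq_le : d ^ 2 ≤ 2 ^ d := sq_le_two_pow hd
  calc 2 * d + 4 * d ^ 2
    _ ≤ (d ^ 2) ^ 2 := by nlinarith [Nat.pow_le_pow_left hd 2]
    _ ≤ (2 ^ d) ^ 2 := by gcongr
    _ ≤ 2 ^ 2 ^ d := sq_le_two_pow (by nlinarith)
    _ ≤ 2 ^ 2 ^ 2 ^ d := Nat.lt_two_pow_self.le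

theorem Algorithm.exists_isQuietSize_mul_lt (A : Algorithm M Out) (model : CDModel) {L : ℕ}
    (hd : 4 ≤ d) (hL : L ≤ d) (t : ℕ) :
    ∃ m n, d < m ∧ 2 ^ L * m < n ∧ n ≤ 2 ^ 2 ^ 2 ^ 2 ^ d ∧
      A.IsQuietSize model d t m ∧ A.IsQuietSize model d t n := by
  obtain ⟨k, hdk, hk, hqk⟩ := A.exists_isQuietSize model (by omega : d ≠ 0) t d
  obtain ⟨l, hkl, hl, hql⟩ := A.exists_isQuietSize model (by omega : d ≠ 0) t (L + k)
  have := two_mul_add_four_mul_sq_le hd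
  refine ⟨2 ^ k, 2 ^ l, hdk.trans Nat.lt_two_pow_self, ?_, ?_, hqk, hql⟩
  · rw [← pow_add]
    exact Nat.pow_lt_pow_right one_lt_two hkl
  · exact Nat.pow_le_pow_right two_pos (by omega)

theorem Algorithm.IsQuietSize.prob_exists_rests_le {ι : Type*} (hq : A.IsQuietSize model d t n)
    (hm : model = .senderCD ∨ model = .noCD) (hd : d ≤ t) (s : Fin n) (J : Finset ι) (a b : ι → ℕ)
    (hJ : ∀ j ∈ J, b j ≤ d ∨ a j = d ∧ b j = t) :
    prob (A.exec model n t) {H | ∃ j ∈ J, Rests (a j) (b j) (H s)} ≤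
      (d : ℝ≥0∞)⁻¹ + ∑ j ∈ J, prob (A.solo model t) {h | Rests (a j) (b j) h} := by
  calc prob (A.exec model n t) {H | ∃ j ∈ J, Rests (a j) (b j) (H s)}
    _ ≤ prob (independent n fun _ => A.solo model t)
          ({G | ¬ Quiet d G} ∪ {G | ∃ j ∈ J, G s ∈ {h | Rests (a j) (b j) h}}) := by
        refine prob_exec_le_prob_solo fun X hX ⟨j, hj, hr⟩ => ?_
        refine or_iff_not_imp_left.2 fun hX' => ⟨j, hj, ?_⟩
        have hX' : Quiet d X.2 := not_not.1 hX'
        rcases hJ j hj with hb | ⟨ha, hb⟩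
        · have := congrArg (List.take (b j)) (take_eq_take_of_quiet hm hd hX hX' s)
          rw [List.take_take, List.take_take, min_eq_left hb] at this
          exact (rests_congr this).1 hr
        · rw [ha, hb] at hr ⊢
          rwa [eq_of_quiet_of_rests hm hd hX hX' (.inl hr)] at hr
    _ ≤ (d : ℝ≥0∞)⁻¹ + ∑ j ∈ J, prob (A.solo model t) {h | Rests (a j) (b j) h} := by
        refine (prob_union_le _ _ _).trans (add_le_add hq ?_)
        refine (prob_exists_le _ J fun j =>
          {G : Fin n → History M | G s ∈ {h | Rests (a j) (b j) h}}).trans_eq ?_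
        simp only [prob_independent_solo]

end Transfer

section Problems

variable {M : Type u} {P : Problem} {A : Algorithm M P.Output} {model : CDModel} {n d t : ℕ}
  {T : ℕ → ℕ} {H : Fin n → History M}

theorem Problem.Solved.isSome {out : Fin n → Option P.Output} (h : P.Solved out H) (i : Fin n) :
    (out i).isSome := by
  cases P with
  | approximateCounting κ hκ =>
    obtain ⟨est, -, -, h⟩ := h
    rw [h i]; rfl
  | leaderElection =>
    obtain ⟨ℓ, hℓ, h, -⟩ := h
    by_cases hi : i = ℓ
    · rw [hi, hℓ]; rfl
    · rw [h i hi]; rfl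
  | contentionResolution => rw [(h i).1]; rfl

theorem Algorithm.Success.advance_eq (h : A.Success H) (a : Fin n → Action M) :
    A.advance model H a = H :=
  funext fun i => if_pos (Problem.Solved.isSome h i)

theorem Algorithm.SolvesInTime.prob_not_success_le (hA : A.SolvesInTime model T) (hn : 2 ≤ n)
    (ht : T n ≤ t) : prob (A.exec model n t) {H | ¬ A.Success H} ≤ (n : ℝ≥0∞)⁻¹ :=
  calc prob (A.exec model n t) {H | ¬ A.Success H}
    _ ≤ prob (A.exec model n (T n)) {H | ¬ A.Success H} :=
        prob_exec_antitone (fun H a ha hs => ha (by rwa [hs.advance_eq])) ht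
    _ ≤ (n : ℝ≥0∞)⁻¹ := (hA n hn).trans_eq (one_div _)

theorem Algorithm.IsQuietSize.prob_solo_rests_and_le (hq : A.IsQuietSize model d t n)
    (hm : model = .senderCD ∨ model = .noCD) (hA : A.SolvesInTime model T) (hn : 2 ≤ n)
    (hdn : d ≤ n) (hd : d ≤ t) (hT : T n ≤ t) (s : Fin n) {B : Set (History M)}
    (hB : ∀ H : Fin n → History M, (∀ i, (H i).length ≤ t) → A.Success H → Quiet d H →
      Rests d t (H s) → H s ∉ B) :
    prob (A.solo model t) {h | Rests d t h ∧ h ∈ B} ≤ 2 * (d : ℝ≥0∞)⁻¹ := by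
  let p := independent n fun _ => A.solo model t
  have rests_and_quiet_le : prob p {G | Quiet d G ∧ Rests d t (G s) ∧ G s ∈ B} ≤ (d : ℝ≥0∞)⁻¹ :=
    calc prob p {G | Quiet d G ∧ Rests d t (G s) ∧ G s ∈ B}
      _ ≤ prob (A.exec model n t) {H | ¬ A.Success H} := by
          refine prob_solo_le_prob_exec fun X hX ⟨hXq, hXr, hXB⟩ hX' => ?_
          have hX₁ : X.1 s = X.2 s := eq_of_quiet_of_rests hm hd hX hXq (.inr hXr)
          refine hB X.1 (fun i => (isStateAt_of_mem_support_coupled hX i).1.1) hX' ?_ ?_ ?_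
          · exact (quiet_congr (take_eq_take_of_quiet hm hd hX hXq)).2 hXq
          · rwa [hX₁]
          · rwa [hX₁]
      _ ≤ (n : ℝ≥0∞)⁻¹ := hA.prob_not_success_le hn hT
      _ ≤ (d : ℝ≥0∞)⁻¹ := by gcongr
  calc prob (A.solo model t) {h | Rests d t h ∧ h ∈ B}
    _ = prob p {G | G s ∈ {h | Rests d t h ∧ h ∈ B}} := (prob_independent_solo s _).symm
    _ ≤ prob p ({G | ¬ Quiet d G} ∪ {G | Quiet d G ∧ Rests d t (G s) ∧ G s ∈ B}) :=
        prob_mono_of_mem_support fun G _ hG =>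
          or_iff_not_imp_left.2 fun hGq => ⟨not_not.1 hGq, hG⟩
    _ ≤ (d : ℝ≥0∞)⁻¹ + (d : ℝ≥0∞)⁻¹ :=
        (prob_union_le _ _ _).trans (add_le_add hq rests_and_quiet_le)
    _ = 2 * (d : ℝ≥0∞)⁻¹ := (two_mul _).symm

/-- In every solved network each device has spent energy in a slot with a single transmitter.
This is all that the lower bound uses of leader election and contention resolution. -/
def Problem.NeedsSingle (P : Problem) : Prop :=
  ∀ {M : Type u} {n : ℕ} (out : Fin n → Option P.Output) (H : Fin n → History M), P.Solved out H →
    ∀ s, ∃ k, SpendsAt (H s) k ∧ SingleAt H k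

theorem Problem.needsSingle_leaderElection : Problem.leaderElection.NeedsSingle.{u} := by
  rintro M n out H ⟨ℓ, -, -, k, -, hℓ, hlisten⟩ s
  refine ⟨k, ?_, ℓ, hℓ, fun i hi => by_contra fun hne => (hlisten i hne).not_transmitsAt hi⟩
  by_cases hs : s = ℓ
  · exact hs ▸ hℓ.spendsAt
  · exact (hlisten s hs).spendsAt

theorem Problem.needsSingle_contentionResolution :
    Problem.contentionResolution.NeedsSingle.{u} := by
  intro M n out H h s
  obtain ⟨-, k, hs, hother⟩ := h s
  exact ⟨k, hs.spendsAt, s, hs, fun i hi => by_contra fun hne => hother i hne hi⟩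

theorem Algorithm.IsQuietSize.prob_solo_rests_le_of_needsSingle (hq : A.IsQuietSize model d t n)
    (hP : P.NeedsSingle.{u}) (hm : model = .senderCD ∨ model = .noCD)
    (hA : A.SolvesInTime model T) (hn : 2 ≤ n) (hdn : d ≤ n) (hd : d ≤ t) (hT : T n ≤ t) :
    prob (A.solo model t) {h | Rests d t h} ≤ 2 * (d : ℝ≥0∞)⁻¹ := by
  have := hq.prob_solo_rests_and_le (B := Set.univ) hm hA hn hdn hd hT ⟨0, by omega⟩
    fun H hlen hs hHq hr _ => by
      obtain ⟨k, hk, hsingle⟩ := hP _ H hs ⟨0, by omega⟩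
      have hdk : d ≤ k := not_lt.1 fun hkd => hHq k hkd hsingle
      exact hr k hdk (hk.lt_length.trans_le (hlen _)) hk
  simpa using this

theorem lt_div_of_sq_mul_lt_of_le_mul {κ : ℝ} (hκ : 1 ≤ κ) {m n est : ℝ} (hmn : κ ^ 2 * n < m)
    (hn : est ≤ κ * n) : est < m / κ := by
  rw [lt_div_iff₀ (by positivity)]
  nlinarith

theorem Algorithm.IsQuietSize.prob_solo_rests_le_of_approximateCounting {κ : ℝ} {hκ : 1 ≤ κ} {m : ℕ}
    {A : Algorithm M (Problem.approximateCounting κ hκ).Output}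
    (hqn : A.IsQuietSize model d t n) (hqm : A.IsQuietSize model d t m)
    (hm : model = .senderCD ∨ model = .noCD)
    (hA : A.SolvesInTime model T) (hn : 2 ≤ n) (hm2 : 2 ≤ m) (hdn : d ≤ n) (hdm : d ≤ m)
    (hd : d ≤ t) (hTn : T n ≤ t) (hTm : T m ≤ t) (hnm : κ ^ 2 * n < m) :
    prob (A.solo model t) {h | Rests d t h} ≤ 4 * (d : ℝ≥0∞)⁻¹ := by
  let B (n : ℕ) : Set (History M) := 
    {h | ∃ est : ℝ, A.output h = some est ∧ (n : ℝ) / κ ≤ est ∧ est ≤ κ * n}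
  have rests_diff {n : ℕ} (hq : A.IsQuietSize model d t n) (hn : 2 ≤ n) (hdn : d ≤ n)
      (hT : T n ≤ t) : prob (A.solo model t) {h | Rests d t h ∧ h ∈ (B n)ᶜ} ≤ 2 * (d : ℝ≥0∞)⁻¹ :=
    hq.prob_solo_rests_and_le hm hA hn hdn hd hT ⟨0, by omega⟩
      fun H _ ⟨est, h₁, h₂, hout⟩ _ _ hB => hB ⟨est, hout _, h₁, h₂⟩
  have disjoint : ∀ h ∈ B n, h ∉ B m := by
    rintro h ⟨est, hout, -, hle⟩ ⟨est', hout', hge, -⟩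
    obtain rfl : est = est' := Option.some.inj (hout.symm.trans hout')
    exact (lt_div_of_sq_mul_lt_of_le_mul hκ hnm hle).not_ge hge
  calc prob (A.solo model t) {h | Rests d t h}
    _ ≤ prob (A.solo model t)
          ({h | Rests d t h ∧ h ∈ (B n)ᶜ} ∪ {h | Rests d t h ∧ h ∈ (B m)ᶜ}) :=
        prob_mono_of_mem_support fun h _ hr =>
          (em (h ∈ B n)).symm.imp (⟨hr, ·⟩) fun hh => ⟨hr, disjoint h hh⟩
    _ ≤ 2 * (d : ℝ≥0∞)⁻¹ + 2 * (d : ℝ≥0∞)⁻¹ := (prob_union_le _ _ _).trans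
        (add_le_add (rests_diff hqn hn hdn hTn) (rests_diff hqm hm2 hdm hTm))
    _ = 4 * (d : ℝ≥0∞)⁻¹ := by ring

theorem Algorithm.SolvesInTime.prob_solo_rests_le_of_needsSingle (hA : A.SolvesInTime model T)
    (hP : P.NeedsSingle.{u}) (hm : model = .senderCD ∨ model = .noCD) (hd : 4 ≤ d) (hdt : d ≤ t)
    (hT : ∀ n ≤ 2 ^ 2 ^ 2 ^ 2 ^ d, T n ≤ t) :
    prob (A.solo model t) {h | Rests d t h} ≤ 4 * (d : ℝ≥0∞)⁻¹ := by
  obtain ⟨m, n, hdm, hmn, hn, hq, -⟩ := A.exists_isQuietSize_mul_lt model hd (Nat.zero_le d) t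
  calc prob (A.solo model t) {h | Rests d t h}
    _ ≤ 2 * (d : ℝ≥0∞)⁻¹ :=
        hq.prob_solo_rests_le_of_needsSingle hP hm hA (by omega) hdm.le hdt (hT m (by omega))
    _ ≤ 4 * (d : ℝ≥0∞)⁻¹ := by gcongr; norm_num

theorem exists_prob_solo_rests_le (P : Problem) : ∃ D : ℕ, ∀ (M : Type u) (model : CDModel),
    (model = .senderCD ∨ model = .noCD) → ∀ (A : Algorithm M P.Output) (T : ℕ → ℕ),
      A.SolvesInTime model T → ∀ d t : ℕ, D ≤ d → d ≤ t → (∀ n ≤ 2 ^ 2 ^ 2 ^ 2 ^ d, T n ≤ t) →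
        prob (A.solo model t) {h | Rests d t h} ≤ 4 * (d : ℝ≥0∞)⁻¹ := by
  cases P with
  | approximateCounting κ hκ =>
    obtain ⟨L, hL⟩ := pow_unbounded_of_one_lt (κ ^ 2) (one_lt_two : (1 : ℝ) < 2)
    refine ⟨max 4 L, fun M model hm A T hA d t hd hdt hT => ?_⟩
    obtain ⟨hd4, hdL⟩ := max_le_iff.1 hd
    obtain ⟨m, n, hdm, hmn, hn, hqm, hqn⟩ := A.exists_isQuietSize_mul_lt model hd4 hdL t
    have hm_lt : m < n := (Nat.le_mul_of_pos_left m (by positivity)).trans_lt hmn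
    refine hqm.prob_solo_rests_le_of_approximateCounting hqn hm hA (by omega) (by omega) hdm.le
      (by omega) hdt (hT m (by omega)) (hT n hn) ?_
    calc κ ^ 2 * m
      _ ≤ 2 ^ L * m := by gcongr
      _ < n := by exact_mod_cast hmn
  | leaderElection =>
    exact ⟨4, fun M model hm A T hA d t hd hdt hT =>
      hA.prob_solo_rests_le_of_needsSingle Problem.needsSingle_leaderElection hm hd hdt hT⟩
  | contentionResolution =>
    exact ⟨4, fun M model hm A T hA d t hd hdt hT =>
      hA.prob_solo_rests_le_of_needsSingle Problem.needsSingle_contentionResolution hm hd hdt hT⟩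

end Problems

section Checkpoints

theorem sum_inv_add_two_mul_inv_le {d : ℕ → ℕ} (hd : ∀ j, 2 * d j ≤ d (j + 1)) (i : ℕ) :
    ∑ j ∈ Finset.range i, (d j : ℝ≥0∞)⁻¹ + 2 * (d i : ℝ≥0∞)⁻¹ ≤ 2 * (d 0 : ℝ≥0∞)⁻¹ := by
  induction i with
  | zero => simp
  | succ i ih =>
    have two_mul_inv_le : 2 * (d (i + 1) : ℝ≥0∞)⁻¹ ≤ (d i : ℝ≥0∞)⁻¹ :=
      calc 2 * (d (i + 1) : ℝ≥0∞)⁻¹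
        _ ≤ 2 * (2 * (d i : ℝ≥0∞))⁻¹ := by
            gcongr
            exact_mod_cast hd i
        _ = (d i : ℝ≥0∞)⁻¹ := by
            rw [ENNReal.mul_inv (.inl two_ne_zero) (.inl ENNReal.ofNat_ne_top), ← mul_assoc,
              ENNReal.mul_inv_cancel two_ne_zero ENNReal.ofNat_ne_top, one_mul]
    calc ∑ j ∈ Finset.range (i + 1), (d j : ℝ≥0∞)⁻¹ + 2 * (d (i + 1) : ℝ≥0∞)⁻¹
      _ ≤ ∑ j ∈ Finset.range i, (d j : ℝ≥0∞)⁻¹ + ((d i : ℝ≥0∞)⁻¹ + (d i : ℝ≥0∞)⁻¹) := by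
          rw [Finset.sum_range_succ, add_assoc]
          gcongr
      _ ≤ 2 * (d 0 : ℝ≥0∞)⁻¹ := by rwa [← two_mul]

theorem inv_add_sum_four_mul_inv_le {d : ℕ → ℕ} (hd : ∀ j, 2 * d j ≤ d (j + 1)) (hd₀ : 16 ≤ d 0)
    (i : ℕ) :
    (d i : ℝ≥0∞)⁻¹ + ∑ j ∈ Finset.range (i + 1), 4 * (d j : ℝ≥0∞)⁻¹ ≤ 2⁻¹ :=
  calc (d i : ℝ≥0∞)⁻¹ + ∑ j ∈ Finset.range (i + 1), 4 * (d j : ℝ≥0∞)⁻¹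
    _ = 4 * ∑ j ∈ Finset.range i, (d j : ℝ≥0∞)⁻¹ + 5 * (d i : ℝ≥0∞)⁻¹ := by
        rw [← Finset.mul_sum, Finset.sum_range_succ]; ring
    _ ≤ 4 * (∑ j ∈ Finset.range i, (d j : ℝ≥0∞)⁻¹ + 2 * (d i : ℝ≥0∞)⁻¹) := by
        rw [mul_add, ← mul_assoc]; gcongr; norm_num
    _ ≤ 4 * (2 * 16⁻¹) := by
        gcongr
        refine (sum_inv_add_two_mul_inv_le hd i).trans ?_
        gcongr
        exact_mod_cast hd₀
    _ = 2⁻¹ := by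
        rw [← ENNReal.toReal_eq_toReal_iff' (by finiteness) (by finiteness)]
        norm_num

variable {M : Type u} {Out : Type} {A : Algorithm M Out} {model : CDModel} {n : ℕ}

theorem Algorithm.IsQuietSize.half_le_prob_spends {d : ℕ → ℕ} {i : ℕ}
    (hq : A.IsQuietSize model (d i) (d (i + 1)) n) (hm : model = .senderCD ∨ model = .noCD)
    (hd : ∀ j, 2 * d j ≤ d (j + 1)) (hd₀ : 16 ≤ d 0)
    (hsolo : ∀ j ≤ i, prob (A.solo model (d (j + 1))) {h | Rests (d j) (d (j + 1)) h} ≤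
      4 * (d j : ℝ≥0∞)⁻¹) (s : Fin n) :
    1 / 2 ≤ prob (A.exec model n (d (i + 1)))
      {H | ∀ j ≤ i, ∃ k, d j ≤ k ∧ k < d (j + 1) ∧ SpendsAt (H s) k} := by
  have hmono : Monotone d := monotone_nat_of_le_succ fun j => by have := hd j; omega
  set p := A.exec model n (d (i + 1))
  set S := {H : Fin n → History M | ∀ j ≤ i, ∃ k, d j ≤ k ∧ k < d (j + 1) ∧ SpendsAt (H s) k}
  have compl_le : prob p Sᶜ ≤ 2⁻¹ :=
    calc prob p Sᶜ
      _ ≤ prob p {H | ∃ j ∈ Finset.range (i + 1), Rests (d j) (d (j + 1)) (H s)} := by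
          refine prob_mono_of_mem_support fun H _ hH => ?_
          simpa [S, Rests] using hH
      _ ≤ (d i : ℝ≥0∞)⁻¹ + ∑ j ∈ Finset.range (i + 1),
            prob (A.solo model (d (i + 1))) {h | Rests (d j) (d (j + 1)) h} := by
          refine hq.prob_exists_rests_le hm (hmono i.le_succ) s _ d (fun j => d (j + 1))
            fun j hj => ?_
          rcases Nat.lt_succ_iff_lt_or_eq.1 (Finset.mem_range.1 hj) with hj | rfl
          exacts [.inl (hmono hj), .inr ⟨rfl, rfl⟩]
      _ ≤ (d i : ℝ≥0∞)⁻¹ + ∑ j ∈ Finset.range (i + 1), 4 * (d j : ℝ≥0∞)⁻¹ := by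
          gcongr with j hj
          have hj := Finset.mem_range_succ_iff.1 hj
          exact (prob_solo_rests_antitone (hmono (Nat.succ_le_succ hj))).trans (hsolo j hj)
      _ ≤ 2⁻¹ := inv_add_sum_four_mul_inv_le hd hd₀ i
  calc (1 / 2 : ℝ≥0∞)
    _ = 1 - 2⁻¹ := by rw [ENNReal.one_sub_inv_two, one_div]
    _ ≤ 1 - prob p Sᶜ := tsub_le_tsub_left compl_le 1
    _ = prob p S := (prob_eq_one_sub_prob_compl p S).symm

variable {T : ℕ → ℕ} {d₁ : ℕ}

theorem two_mul_checkpoint_le (hT : ∀ n, n ≤ T n) (j : ℕ) :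
    2 * checkpoint T d₁ j ≤ checkpoint T d₁ (j + 1) := by
  refine le_trans ?_ (hT _)
  generalize checkpoint T d₁ j = d
  calc 2 * d
    _ ≤ 2 ^ (d + 1) := by rw [pow_succ']; gcongr; exact Nat.lt_two_pow_self.le
    _ ≤ 2 ^ 2 ^ d := by gcongr; exacts [one_le_two, Nat.lt_two_pow_self]
    _ ≤ 2 ^ 2 ^ 2 ^ d := Nat.lt_two_pow_self.le
    _ ≤ 2 ^ 2 ^ 2 ^ 2 ^ d := Nat.lt_two_pow_self.le

theorem monotone_checkpoint (hT : ∀ n, n ≤ T n) : Monotone (checkpoint T d₁) :=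
  monotone_nat_of_le_succ fun j => by
    have := two_mul_checkpoint_le (d₁ := d₁) hT j
    omega

theorem le_checkpoint (hT : ∀ n, n ≤ T n) (j : ℕ) : d₁ ≤ checkpoint T d₁ j :=
  monotone_checkpoint hT (Nat.zero_le j)

theorem exists_size_spending (P : Problem) : ∃ D : ℕ, ∀ (M : Type u) (model : CDModel),
    (model = .senderCD ∨ model = .noCD) →
      ∀ (A : Algorithm M P.Output) (T : ℕ → ℕ), Monotone T → (∀ n, n ≤ T n) →
        A.SolvesInTime model T →
        ∀ d₁ : ℕ, D ≤ d₁ → ∀ i : ℕ, ∃ n : ℕ,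
          checkpoint T d₁ i + 1 ≤ n ∧ n ≤ checkpoint T d₁ (i + 1) ∧
          ∀ s : Fin n,
            1 / 2 ≤ prob (A.exec model n (checkpoint T d₁ (i + 1)))
              {H | ∀ j ≤ i, ∃ k, checkpoint T d₁ j ≤ k ∧ k < checkpoint T d₁ (j + 1) ∧
                SpendsAt (H s) k} := by
  obtain ⟨D, hD⟩ := exists_prob_solo_rests_le P
  refine ⟨max 16 D, fun M model hm A T hT hle hA d₁ hd₁ i => ?_⟩
  obtain ⟨hd16, hdD⟩ := max_le_iff.1 hd₁
  have hd4 : 4 ≤ checkpoint T d₁ i := le_trans (by omega) (le_checkpoint hle i)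
  obtain ⟨n, m, hdn, hnm, hm_le, hq, -⟩ :=
    A.exists_isQuietSize_mul_lt model hd4 (Nat.zero_le _) (checkpoint T d₁ (i + 1))
  have hn : n ≤ 2 ^ 2 ^ 2 ^ 2 ^ checkpoint T d₁ i := by omega
  exact ⟨n, hdn, hn.trans (hle _), hq.half_le_prob_spends hm (two_mul_checkpoint_le hle) hd16
    fun j _ => hD M model hm A T hA _ _ (hdD.trans (le_checkpoint hle j))
      (monotone_checkpoint hle j.le_succ) fun n hn => hT hn⟩

end Checkpoints

section Energy

variable {M : Type u} {P : Problem} {A : Algorithm M P.Output} {model : CDModel} {n : ℕ}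
  {T E : ℕ → ℕ}

theorem energy_le_of_sublist {h h' : History M} (hh : h.Sublist h') : energy h ≤ energy h' :=
  hh.countP_le

theorem SpendsAt.energy_take_lt {h : History M} {a b k : ℕ} (hk : SpendsAt h k) (ha : a ≤ k)
    (hb : k < b) : energy (h.take a) < energy (h.take b) := by
  obtain ⟨e, he, hc⟩ := hk
  calc energy (h.take a)
    _ ≤ energy (h.take k) := energy_le_of_sublist (List.take_sublist_take_left ha)
    _ < energy (h.take (k + 1)) := by simp [energy, List.take_add_one, he, hc]
    _ ≤ energy (h.take b) := energy_le_of_sublist (List.take_sublist_take_left hb)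

theorem lt_energy_of_spendsAt {h : History M} {d : ℕ → ℕ} {i : ℕ}
    (hs : ∀ j ≤ i, ∃ k, d j ≤ k ∧ k < d (j + 1) ∧ SpendsAt h k) : i < energy h := by
  have le_energy_take (j : ℕ) (hj : j ≤ i + 1) : j ≤ energy (h.take (d j)) := by
    induction j with
    | zero => exact Nat.zero_le _
    | succ j ih =>
      obtain ⟨k, hk, hk', hsp⟩ := hs j (by omega)
      exact (ih (by omega)).trans_lt (hsp.energy_take_lt hk hk')
  exact (le_energy_take (i + 1) le_rfl).trans (energy_le_of_sublist (List.take_sublist _ _))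

theorem Algorithm.SolvesInTimeEnergy.solvesInTime {T' : ℕ → ℕ}
    (hA : A.SolvesInTimeEnergy model T E) (hT : ∀ n, 1 ≤ n → T n ≤ T' n) :
    A.SolvesInTime model T' := fun n hn =>
  calc prob (A.exec model n (T' n)) {H | ¬ A.Success H}
    _ ≤ prob (A.exec model n (T n)) {H | ¬ A.Success H} :=
        prob_exec_antitone (fun H a ha hs => ha (by rwa [hs.advance_eq])) (hT n (by omega))
    _ ≤ prob (A.exec model n (T n)) {H | ¬ (A.Success H ∧ ∀ i, energy (H i) ≤ E n)} :=
        prob_mono_of_mem_support fun H _ hs h => hs h.1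
    _ ≤ 1 / n := hA n hn

theorem Algorithm.SolvesInTimeEnergy.lt_energy (hA : A.SolvesInTimeEnergy model T E) (hn : 3 ≤ n)
    {i t : ℕ} (s : Fin n) (hs : 1 / 2 ≤ prob (A.exec model n t) {H | i < energy (H s)}) :
    i < E n := by
  by_contra! hE
  have energy_le_advance (H : Fin n → History M) (a : Fin n → Action M) :
      energy (H s) ≤ energy (A.advance model H a s) :=
    energy_le_of_sublist (prefix_step (A := A)).sublist
  have half_le_inv : (1 / 2 : ℝ≥0∞) ≤ 1 / n :=
    calc (1 / 2 : ℝ≥0∞)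
      _ ≤ prob (A.exec model n t) {H | i < energy (H s)} := hs
      _ ≤ prob (A.exec model n (max t (T n))) {H | i < energy (H s)} :=
          prob_exec_monotone (fun H a hi => lt_of_lt_of_le hi (energy_le_advance H a))
            (le_max_left ..)
      _ ≤ prob (A.exec model n (max t (T n)))
            {H | ¬ (A.Success H ∧ ∀ i, energy (H i) ≤ E n)} :=
          prob_mono_of_mem_support fun H _ hi h => ((h.2 s).trans hE).not_gt hi
      _ ≤ prob (A.exec model n (T n)) {H | ¬ (A.Success H ∧ ∀ i, energy (H i) ≤ E n)} :=
          prob_exec_antitone (fun H a ha h => ha (by rwa [h.1.advance_eq])) (le_max_right ..)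
      _ ≤ 1 / n := hA n (by omega)
  simp only [one_div, ENNReal.inv_le_inv] at half_le_inv
  have : n ≤ 2 := by exact_mod_cast half_le_inv
  omega

end Energy

section Tower

theorem tower_succ (α x : ℕ) : tower (α + 1) x = 2 ^ tower α x := by
  rw [tower, Function.iterate_succ_apply']; rfl

theorem tower_add (α β x : ℕ) : tower (α + β) x = tower α (tower β x) :=
  Function.iterate_add_apply _ α β x

theorem monotone_tower (α : ℕ) : Monotone (tower α) :=
  Monotone.iterate (fun _ _ h => Nat.pow_le_pow_right (by norm_num) h) α

theorem le_tower (α x : ℕ) : x ≤ tower α x := by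
  induction α with
  | zero => exact le_rfl
  | succ α ih => rw [tower_succ]; exact ih.trans Nat.lt_two_pow_self.le

theorem monotone_tower_left (x : ℕ) : Monotone fun α => tower α x :=
  monotone_nat_of_le_succ fun α => by
    rw [tower_succ]; exact Nat.lt_two_pow_self.le

theorem le_tower_one (d : ℕ) : d ≤ tower d 1 := by
  induction d with
  | zero => exact Nat.zero_le _
  | succ d ih => rw [tower_succ]; exact ih.trans_lt Nat.lt_two_pow_self

theorem exists_iterate_logb_le_one {k : ℕ} {x : ℝ} (h : x ≤ tower k 1) :
    ∃ j ≤ k, (Real.logb 2)^[j] x ≤ 1 := by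
  induction k generalizing x with
  | zero => exact ⟨0, le_rfl, by simpa [tower] using h⟩
  | succ k ih =>
    by_cases hx : x ≤ 1
    · exact ⟨0, Nat.zero_le _, hx⟩
    · have hx₀ : 0 < x := by linarith
      rw [tower_succ] at h
      push_cast at h
      obtain ⟨j, hj, hle⟩ := ih (x := Real.logb 2 x) (by
        rw [Real.logb_le_iff_le_rpow one_lt_two hx₀]
        exact_mod_cast h)
      exact ⟨j + 1, by omega, hle⟩

theorem le_tower_of_iterate_logb_le_one {k : ℕ} {x : ℝ} (h : (Real.logb 2)^[k] x ≤ 1) :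
    x ≤ tower k 1 := by
  induction k generalizing x with
  | zero => simpa [tower] using h
  | succ k ih =>
    by_cases hx : x ≤ 0
    · exact hx.trans (Nat.cast_nonneg _)
    · have h := ih h
      rw [Real.logb_le_iff_le_rpow one_lt_two (not_le.1 hx)] at h
      rw [tower_succ]
      push_cast
      exact_mod_cast h

theorem logStar_le_iff {k : ℕ} {x : ℝ} : logStar x ≤ k ↔ x ≤ tower k 1 := by
  constructor
  · intro h
    obtain ⟨m, hm⟩ := exists_nat_ge x
    obtain ⟨j, -, hj⟩ := exists_iterate_logb_le_one
      (hm.trans (Nat.cast_le.2 (le_tower_one m)))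
    have hmem : (Real.logb 2)^[logStar x] x ≤ 1 :=
      Nat.sInf_mem (s := {k : ℕ | (Real.logb 2)^[k] x ≤ 1}) ⟨j, hj⟩
    exact (le_tower_of_iterate_logb_le_one hmem).trans (Nat.cast_le.2 (monotone_tower_left 1 h))
  · intro h
    obtain ⟨j, hj, hle⟩ := exists_iterate_logb_le_one h
    exact (Nat.sInf_le hle).trans hj

end Tower

section LogStar

theorem LogStarEnergyBound.mono {P : Problem} {c : ℝ} {F G : ℕ → ℕ}
    (h : LogStarEnergyBound.{u} c P G) (hFG : ∀ n, F n ≤ G n) : LogStarEnergyBound.{u} c P F := by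
  obtain ⟨N₀, h⟩ := h
  exact ⟨N₀, fun M model hm A T E hT => h M model hm A T E fun n hn => (hT n hn).trans (hFG n)⟩

theorem checkpoint_tower_le {α C d₁ : ℕ} (hC : C < d₁) (hd : 4 ≤ d₁) (i : ℕ) :
    checkpoint (fun n => C * tower α n + n) d₁ i ≤ tower (i * (α + 5)) d₁ := by
  induction i with
  | zero => simp [checkpoint, tower]
  | succ i ih =>
    have hle := le_checkpoint (T := fun n => C * tower α n + n) (d₁ := d₁)
      (fun n => Nat.le_add_left n _) i
    rw [checkpoint]
    generalize checkpoint (fun n => C * tower α n + n) d₁ i = d at ih hle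
    have hy : d ≤ tower (α + 4) d := le_tower _ _
    calc C * tower α (2 ^ 2 ^ 2 ^ 2 ^ d) + 2 ^ 2 ^ 2 ^ 2 ^ d
      _ = C * tower (α + 4) d + tower 4 d := by rw [tower_add]; rfl
      _ ≤ C * tower (α + 4) d + tower (α + 4) d := by
          gcongr
          exact monotone_tower_left d (Nat.le_add_left 4 α)
      _ = (C + 1) * tower (α + 4) d := by ring
      _ ≤ tower (α + 4) d ^ 2 := by rw [pow_two]; gcongr; omega
      _ ≤ 2 ^ tower (α + 4) d := sq_le_two_pow (by omega)
      _ = tower (α + 5) d := (tower_succ _ _).symm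
      _ ≤ tower (α + 5) (tower (i * (α + 5)) d₁) := monotone_tower _ ih
      _ = tower ((i + 1) * (α + 5)) d₁ := by rw [← tower_add]; congr 1; ring

theorem exists_lt_energy_le_tower (α : ℕ) (P : Problem) (C : ℕ) :
    ∃ d₁ : ℕ, ∀ (M : Type u) (model : CDModel), (model = .senderCD ∨ model = .noCD) →
      ∀ (A : Algorithm M P.Output) (T E : ℕ → ℕ), (∀ n, 1 ≤ n → T n ≤ C * tower α n) →
        A.SolvesInTimeEnergy model T E →
          ∀ i : ℕ, ∃ n, 2 ≤ n ∧ n ≤ tower ((i + 1) * (α + 5)) d₁ ∧ i < E n := by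
  obtain ⟨D, hD⟩ := exists_size_spending.{u} P
  refine ⟨D + C + 4, fun M model hm A T E hT hA i => ?_⟩
  let T' (n : ℕ) : ℕ := C * tower α n + n
  have hT' : Monotone T' := fun x y hxy =>
    add_le_add (Nat.mul_le_mul_left _ (monotone_tower α hxy)) hxy
  have hle (n : ℕ) : n ≤ T' n := Nat.le_add_left n _
  obtain ⟨n, hn, hn', hs⟩ := hD M model hm A T' hT' hle
    (hA.solvesInTime fun n hn => (hT n hn).trans (Nat.le_add_right _ _)) (D + C + 4) (by omega) i
  have hn3 : 3 ≤ n := by have := le_checkpoint (d₁ := D + C + 4) hle i; omega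
  refine ⟨n, by omega, hn'.trans (checkpoint_tower_le (by omega) (by omega) _), ?_⟩
  exact hA.lt_energy hn3 ⟨0, by omega⟩ <| (hs ⟨0, by omega⟩).trans <|
    prob_mono_of_mem_support fun H _ h => lt_energy_of_spendsAt h

theorem exists_tower_le_and_logStar_le {b : ℕ} (hb : 0 < b) (d : ℕ) :
    ∃ N₀ : ℕ, ∀ N : ℕ, N₀ ≤ N →
      ∃ i : ℕ, tower ((i + 1) * b) d ≤ N ∧ logStar N ≤ 2 * b * (i + 1) := by
  refine ⟨tower (2 * (d + 1 + b)) 1 + 1, fun N hN => ?_⟩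
  have lt_logStar : 2 * (d + 1 + b) < logStar N := by
    refine lt_of_not_ge fun h => ?_
    have : N ≤ tower (2 * (d + 1 + b)) 1 := by exact_mod_cast logStar_le_iff.1 h
    omega
  have tower_le : tower (logStar N - 1) 1 ≤ N := by
    refine le_of_not_gt fun h => ?_
    have : logStar N ≤ logStar N - 1 := logStar_le_iff.2 (by exact_mod_cast h.le)
    omega
  generalize logStar N = m at lt_logStar tower_le ⊢
  obtain ⟨q, r, hr, hqr⟩ : ∃ q r, r < b ∧ q * b + r = m - 1 - d :=
    ⟨_, _, Nat.mod_lt _ hb, Nat.div_add_mod' _ _⟩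
  have hm : m ≤ 2 * b * q := by linarith [show m ≤ 2 * (q * b) by omega]
  obtain ⟨i, rfl⟩ : ∃ i, q = i + 1 :=
    Nat.exists_eq_succ_of_ne_zero fun h => by simp [h] at hm; omega
  refine ⟨i, ?_, hm⟩
  calc tower ((i + 1) * b) d
    _ ≤ tower ((i + 1) * b) (tower d 1) := monotone_tower _ (le_tower_one d)
    _ = tower ((i + 1) * b + d) 1 := (tower_add _ _ _).symm
    _ ≤ tower (m - 1) 1 := monotone_tower_left 1 (by omega)
    _ ≤ N := tower_le

theorem logStarEnergyBound_tower (α : ℕ) (P : Problem) (C : ℕ) :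
    LogStarEnergyBound.{u} (1 / (2 * (α + 5))) P fun n => C * tower α n := by
  obtain ⟨d₁, hd₁⟩ := exists_lt_energy_le_tower.{u} α P C
  obtain ⟨N₀, hN₀⟩ := exists_tower_le_and_logStar_le (b := α + 5) (by omega) d₁
  refine ⟨N₀, fun M model hm A T E hT hA N hN => ?_⟩
  obtain ⟨i, hiN, hlog⟩ := hN₀ N hN
  obtain ⟨n, hn2, hn, hE⟩ := hd₁ M model hm A T E hT hA i
  refine ⟨n, hn2, hn.trans hiN, ?_⟩
  rw [one_div, inv_mul_le_iff₀ (by positivity)]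
  calc (logStar N : ℝ)
    _ ≤ 2 * (α + 5) * (i + 1) := by exact_mod_cast hlog
    _ ≤ 2 * (α + 5) * E n := by gcongr; exact_mod_cast hE

theorem exists_pow_le_mul_two_pow (k : ℕ) : ∃ K : ℕ, ∀ n : ℕ, n ^ k ≤ K * 2 ^ n := by
  obtain ⟨B, hB⟩ := (tendsto_pow_const_div_const_pow_of_one_lt k
    (one_lt_two : (1 : ℝ) < 2)).bddAbove_range
  obtain ⟨K, hK⟩ := exists_nat_ge B
  refine ⟨K, fun n => ?_⟩
  have h := (hB ⟨n, rfl⟩).trans hK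
  rw [div_le_iff₀ (by positivity)] at h
  exact_mod_cast h

theorem logStarEnergyBound_pow (P : Problem) (k C : ℕ) :
    LogStarEnergyBound.{u} (1 / 12) P fun n => C * n ^ k := by
  obtain ⟨K, hK⟩ := exists_pow_le_mul_two_pow k
  have bound_tower : LogStarEnergyBound.{u} (1 / 12) P fun n => C * K * tower 1 n := by
    convert logStarEnergyBound_tower.{u} 1 P (C * K) using 1
    norm_num
  refine bound_tower.mono fun n => ?_
  rw [mul_assoc]
  exact Nat.mul_le_mul_left C (hK n)

end LogStar

end RadioNetwork

theorem mainTheorem1 :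
    -- polynomial time
    (∃ c : ℝ, 0 < c ∧ ∀ (P : Problem) (k C : ℕ),
      LogStarEnergyBound.{u} c P fun n => C * n ^ k) ∧
    -- time bounded by a tower of exponentials of constant height
    (∀ α : ℕ, ∃ c : ℝ, 0 < c ∧ ∀ (P : Problem) (C : ℕ),
      LogStarEnergyBound.{u} c P fun n => C * tower α n) ∧
    -- arbitrary time bounds: one unit of energy between any two consecutive checkpoints
    (∀ P : Problem, ∃ D : ℕ, ∀ (M : Type u) (model : CDModel),
      (model = .senderCD ∨ model = .noCD) →
      ∀ (A : Algorithm M P.Output) (T : ℕ → ℕ), Monotone T → (∀ n, n ≤ T n) →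
        A.SolvesInTime model T →
        ∀ d₁ : ℕ, D ≤ d₁ → ∀ i : ℕ, ∃ n : ℕ,
          checkpoint T d₁ i + 1 ≤ n ∧ n ≤ checkpoint T d₁ (i + 1) ∧
          ∀ s : Fin n,
            1 / 2 ≤ prob (A.exec model n (checkpoint T d₁ (i + 1)))
              {H | ∀ j ≤ i, ∃ k, checkpoint T d₁ j ≤ k ∧ k < checkpoint T d₁ (j + 1) ∧
                SpendsAt (H s) k}) := by
  exact ⟨⟨1 / 12, by norm_num, logStarEnergyBound_pow⟩,
    fun α => ⟨1 / (2 * (α + 5)), by positivity, logStarEnergyBound_tower α⟩,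
    exists_size_spending⟩
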